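/- Let $S$ be a nonempty finite or countable set, $t\ge 1$, and let $X_1,\dots,X_t$ be $S$-valued random variables forming a Markov chain with Markov kernels $K_2,\dots,K_t$ on $S$: for $2\le i\le t$ and every $E\subseteq S$, $\mathbb P(X_i\in E\mid X_1,\dots,X_{i-1})=K_i(E\mid X_{i-1})$ almost surely. Write $P_{X_i}$ for the law of $X_i$ (so $P_{X_i}=P_{X_{i-1}}K_i$) and $P_{\bigotimes X_i}=P_{X_1}\otimes\cdots\otimes P_{X_t}$. Let $K_i^\star$ be the dual of $K_i$ with respect to $P_{X_{i-1}}$, i.e. the operator with $\langle K_ig,h\rangle_{P_{X_{i-1}}}=\langle g,K_i^\star h\rangle_{P_{X_i}}$; explicitly $K_i^\star h(y)=\sum_x \frac{K_i(y|x)P_{X_{i-1}}(\{x\})}{P_{X_i}(\{y\})}\,h(x)$ for $P_{X_i}(\{y\})>0$. For $1<p<\infty$ let $$\|K_i^\star\|_{L_p^0\to L_p^0}=\sup\Big\{\tfrac{\|K_i^\star h\|_{L_p(P_{X_i})}}{\|h\|_{L_p(P_{X_{i-1}})}} : h\in L_p(P_{X_{i-1}}),\ P_{X_{i-1}}(h)=0\Big\}\quad(\text{with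 } 0/0=0),$$ $$\omega_p^i=\sup_{x:\,P_{X_{i-1}}(\{x\})>0}\Big((1-P_{X_{i-1}}(\{x\}))^p\,P_{X_{i-1}}(\{x\})^{1-p}+1-P_{X_{i-1}}(\{x\})\Big)^{1/p}\in[0,\infty],$$ so that $\omega_p^i=\sup_x\|d\delta_x/dP_{X_{i-1}}-1\|_{L_p(P_{X_{i-1}})}$ over the same points; the supremum is a maximum if $S$ is finite. Then for every $p\in(1,\infty)$ with $\frac1p+\frac1q=1$, every $f:S^t\to\mathbb R$ such that $|f(x)-f(\hat x)|\le \frac1t$ whenever $x,\hat x\in S^t$ differ in at most one coordinate, and every $\eta\ge 0$, $$\mathbb P\Big(\big|f(X_1,\dots,X_t)-P_{\bigotimes X_i}(f)\big|\ge\eta\Big)\le 2^{1/q}\exp\Big(-\frac{2t\eta^2}{q}\Big)\prod_{i=2}^t\Big(\|K_i^\star\|_{L_p^0\to L_p^0}\,\omega_p^i+1\Big),$$ where $0\cdot\infty=0$. -/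

import Mathlib

open MeasureTheory ProbabilityTheory
open scoped ENNReal

noncomputable section

/-- `X 0, …, X n` is a Markov chain with transition kernels `K 0, …, K (n - 1)` under `P`: for every
measurable `E`, the conditional probability of `X (i + 1) ∈ E` given `X 0, …, X i` is
`K i (E | X i)` almost surely. -/
def IsMarkovChain {Ω S : Type*} [MeasurableSpace Ω] [MeasurableSpace S] {n : ℕ}
    (P : Measure Ω) (X : Fin (n + 1) → Ω → S) (K : Fin n → Kernel S S) : Prop :=
  ∀ i : Fin n, ∀ E : Set S, MeasurableSet E →
    P⟦X i.succ ⁻¹' E | ⨆ j ≤ i.castSucc, MeasurableSpace.comap (X j) inferInstance⟧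
      =ᵐ[P] fun ω => (K i (X i.castSucc ω)).real E

/-- The dual operator `K⋆_μ` of a Markov kernel `K` with respect to a finite measure `μ`, acting
on functions. The kernel `K†μ` is the Bayesian inverse of `K`, characterised by
`(μ K)(dy) (K†μ)(dx | y) = μ(dx) K(dy | x)`, that is, by `⟨K f, g⟩_μ = ⟨f, K⋆_μ g⟩_{μ K}`;
for discrete measures, `(K†μ)({x} | y) = K({y} | x) μ({x}) / (μ K)({y})`. -/
def dualOperator {S : Type*} [MeasurableSpace S] [StandardBorelSpace S] [Nonempty S]
    (K : Kernel S S) [IsMarkovKernel K] (μ : Measure S) [IsFiniteMeasure μ]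
    (g : S → ℝ) (y : S) : ℝ :=
  ∫ x, g x ∂((K†μ) y)

/-- The contraction coefficient `‖K⋆_μ‖_{L_p^0 → L_p^0}`: the supremum of
`‖K⋆_μ g‖_{L_p(μ K)} / ‖g‖_{L_p(μ)}` over the functions `g ∈ L_p(μ)` of `μ`-mean zero, as an extended
non-negative number, with the convention `0 / 0 = 0`. -/
def dualContractionCoeff {S : Type*} [MeasurableSpace S] [StandardBorelSpace S] [Nonempty S]
    (p : ℝ≥0∞) (K : Kernel S S) [IsMarkovKernel K] (μ : Measure S) [IsFiniteMeasure μ] :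
    ℝ≥0∞ :=
  ⨆ (g : S → ℝ) (_ : MemLp g p μ) (_ : ∫ x, g x ∂μ = 0),
    eLpNorm (dualOperator K μ g) p (K ∘ₘ μ) / eLpNorm g p μ

/-- `ω_p(μ) = max_x ((1 - μ{x})^p μ{x}^(1 - p) + (1 - μ{x}))^(1/p)`, over the atoms `x` of `μ`
(these are the points where `δ_x ≪ μ`). The supremum may be `∞` if there are infinitely many. -/
def pointMassNorm {S : Type*} [MeasurableSpace S] (p : ℝ) (μ : Measure S) : ℝ≥0∞ :=
  ⨆ (x : S) (_ : μ {x} ≠ 0),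
    ((1 - μ {x}) ^ p * μ {x} ^ (1 - p) + (1 - μ {x})) ^ (1 / p)

/-- Every change of one single coordinate changes `f` by at most `c`. -/
def HasBoundedDifferences {ι S : Type*} (f : (ι → S) → ℝ) (c : ℝ) : Prop :=
  ∀ (i : ι) (x y : ι → S), (∀ j, j ≠ i → x j = y j) → |f x - f y| ≤ c

end

/-! ### McDiarmid's inequality -/

section McDiarmid

variable {S : Type*} {n : ℕ} {c : ℝ}

/-! The proof is a change of measure from the chain to independent coordinates. On a countable space
the joint law has density `∏ k_j(x_j, x_{j+1})` with respect to the product `Q` of the marginals,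
where `k_j(x, y) = K_j(y | x) / P_{X_{j+1}}(y)` (`IsMarkovChain.map_eq_withDensity`). Hölder's
inequality bounds the probability of the deviation event `A` by the `L_p(Q)` norm of this density
times `Q(A)^(1/q)`, and McDiarmid's inequality controls `Q(A)`.

The norm factorises by integrating out the last coordinate repeatedly (`lintegral_pi_prod_le`),
since each `‖k_j(x, ·)‖_p` is bounded uniformly over atoms `x`. For that bound, Bayes' rule gives
`k_j(x, ·) = K⋆(dδ_x/dμ)`. As `K⋆ 1 = 1`, this is `1 + K⋆(dδ_x/dμ - 1)`; the last argument has mean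
zero, so contraction and Minkowski give `‖K⋆‖ ω + 1` (`lintegral_singleton_div_rpow_le`). -/

lemma HasBoundedDifferences.comp_cons {f : (Fin (n + 1) → S) → ℝ}
    (hf : HasBoundedDifferences f c) (a : S) :
    HasBoundedDifferences (fun y : Fin n → S => f (Fin.cons a y)) c := by
  refine fun i x y hxy => hf i.succ _ _ fun j hj => ?_
  induction j using Fin.cases with
  | zero => rfl
  | succ j => exact hxy j fun h => hj (congrArg Fin.succ h)

lemma HasBoundedDifferences.abs_cons_sub_cons_le {f : (Fin (n + 1) → S) → ℝ}
    (hf : HasBoundedDifferences f c) (a b : S) (y : Fin n → S) :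
    |f (Fin.cons a y) - f (Fin.cons b y)| ≤ c := by
  refine hf 0 _ _ fun j hj => ?_
  induction j using Fin.cases with
  | zero => exact absurd rfl hj
  | succ j => rfl

lemma HasBoundedDifferences.exists_abs_le [Nonempty S] {f : (Fin n → S) → ℝ}
    (hf : HasBoundedDifferences f c) : ∃ C, ∀ x, |f x| ≤ C := by
  induction n with
  | zero => exact ⟨|f finZeroElim|, fun x => by rw [Subsingleton.elim x finZeroElim]⟩
  | succ n ih =>
    obtain ⟨a⟩ := ‹Nonempty S›
    obtain ⟨C, hC⟩ := ih (hf.comp_cons a)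
    refine ⟨c + C, fun x => ?_⟩
    have h1 := hf.abs_cons_sub_cons_le (x 0) a (Fin.tail x)
    rw [Fin.cons_self_tail] at h1
    have h2 := hC (Fin.tail x)
    have h3 := abs_add_le (f x - f (Fin.cons a (Fin.tail x))) (f (Fin.cons a (Fin.tail x)))
    rw [sub_add_cancel] at h3
    linarith

variable [MeasurableSpace S]

lemma integrable_of_measurable_of_abs_le {α : Type*} [MeasurableSpace α] {μ : Measure α}
    [IsFiniteMeasure μ] {f : α → ℝ} (hf : Measurable f) {C : ℝ} (hC : ∀ x, |f x| ≤ C) :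
    Integrable f μ :=
  Integrable.of_bound hf.aestronglyMeasurable C (.of_forall hC)

lemma integrable_exp_mul_of_abs_le {α : Type*} [MeasurableSpace α] {μ : Measure α}
    [IsFiniteMeasure μ] {f : α → ℝ} (hf : Measurable f) {C : ℝ} (hC : ∀ x, |f x| ≤ C) (t : ℝ) :
    Integrable (fun x => Real.exp (t * f x)) μ := by
  refine integrable_of_measurable_of_abs_le (by fun_prop) (C := Real.exp (|t| * C)) fun x => ?_
  rw [Real.abs_exp, Real.exp_le_exp]
  refine (le_abs_self _).trans ?_
  rw [abs_mul]
  exact mul_le_mul_of_nonneg_left (hC x) (abs_nonneg t)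

/-- **Hoeffding's lemma** for a function of oscillation at most `c`. -/
lemma integral_exp_mul_sub_integral_le {μ : Measure S} [IsProbabilityMeasure μ] {g : S → ℝ}
    (hg : Measurable g) (hc : ∀ x y, |g x - g y| ≤ c) (t : ℝ) :
    ∫ x, Real.exp (t * (g x - ∫ z, g z ∂μ)) ∂μ ≤ Real.exp ((c / 2) ^ 2 * t ^ 2 / 2) := by
  have : Nonempty S := nonempty_of_isProbabilityMeasure μ
  obtain ⟨a⟩ := this
  have hle : ∀ x, g x ≤ g a + c := fun x => by linarith [(abs_le.1 (hc x a)).2]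
  have hge : ∀ x, g a - c ≤ g x := fun x => by linarith [(abs_le.1 (hc x a)).1]
  have hbb : BddBelow (Set.range g) := ⟨_, by rintro _ ⟨x, rfl⟩; exact hge x⟩
  have hba : BddAbove (Set.range g) := ⟨_, by rintro _ ⟨x, rfl⟩; exact hle x⟩
  have hne : Nonempty S := ⟨a⟩
  -- Hoeffding's lemma needs an interval of length `c`, whereas `hge` and `hle` only give length
  -- `2c`; the interval from infimum to supremum is short enough.
  have hosc : (⨆ x, g x) - ⨅ x, g x ≤ c := by
    rw [sub_le_iff_le_add]
    refine ciSup_le fun x => ?_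
    rw [← sub_le_iff_le_add']
    exact le_ciInf fun y => by linarith [(abs_le.1 (hc x y)).2]
  have hpos : 0 ≤ (⨆ x, g x) - ⨅ x, g x :=
    sub_nonneg.2 ((ciInf_le hbb a).trans (le_ciSup hba a))
  have h := (hasSubgaussianMGF_of_mem_Icc (μ := μ) hg.aemeasurable
    (.of_forall fun x => ⟨ciInf_le hbb x, le_ciSup hba x⟩)).mgf_le t
  refine h.trans (Real.exp_le_exp.2 ?_)
  simp only [NNReal.coe_pow, NNReal.coe_div, coe_nnnorm, NNReal.coe_ofNat, Real.norm_eq_abs,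
    abs_of_nonneg hpos]
  gcongr

/-- The exponential moment estimate behind **McDiarmid's inequality**. -/
theorem HasBoundedDifferences.integral_exp_le {f : (Fin n → S) → ℝ} (hf : HasBoundedDifferences f c)
    (hm : Measurable f) (μ : Fin n → Measure S) [∀ i, IsProbabilityMeasure (μ i)] (t : ℝ) :
    ∫ x, Real.exp (t * (f x - ∫ z, f z ∂(Measure.pi μ))) ∂(Measure.pi μ) ≤
      Real.exp (n * (c / 2) ^ 2 * t ^ 2 / 2) := by
  induction n with
  | zero =>
    rw [Measure.pi_of_empty μ finZeroElim]
    simp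
  | succ n ih =>
    have : Nonempty S := nonempty_of_isProbabilityMeasure (μ 0)
    obtain ⟨C, hC⟩ := hf.exists_abs_le
    set ν := Measure.pi fun j : Fin n => μ j.succ with hν
    have hmp : MeasurePreserving (fun z : S × (Fin n → S) => (Fin.cons z.1 z.2 : Fin (n + 1) → S))
        ((μ 0).prod ν) (Measure.pi μ) := by
      have := (measurePreserving_piFinSuccAbove μ 0).symm
      simpa [MeasurableEquiv.piFinSuccAbove, Fin.insertNthEquiv] using! this
    set F : S → (Fin n → S) → ℝ := fun a y => f (Fin.cons a y) with hF
    have hFm : Measurable (fun z : S × (Fin n → S) => F z.1 z.2) := hm.comp hmp.measurable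
    have hFm' : ∀ y, Measurable (fun a => F a y) := fun y => hFm.comp measurable_prodMk_right
    have hFi : ∀ y, Integrable (fun a => F a y) (μ 0) := fun y =>
      integrable_of_measurable_of_abs_le (hFm' y) fun a => hC _
    -- Averaging out the first coordinate preserves bounded differences, so the induction hypothesis
    -- applies to `g`, while Hoeffding's lemma handles `F · y - g y` for each fixed `y`.
    set g : (Fin n → S) → ℝ := fun y => ∫ a, F a y ∂(μ 0) with hg
    have hgm : Measurable g :=
      hFm.stronglyMeasurable.integral_prod_left'.measurable
    have hgC : ∀ y, |g y| ≤ C := fun y => by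
      have := norm_integral_le_of_norm_le_const (μ := μ 0) (f := fun a => F a y)
        (.of_forall fun a => hC _)
      simpa using this
    have hgbd : HasBoundedDifferences g c := by
      intro i x y hxy
      have h : g x - g y = ∫ a, (F a x - F a y) ∂(μ 0) := (integral_sub (hFi x) (hFi y)).symm
      rw [h]
      have := norm_integral_le_of_norm_le_const (μ := μ 0) (f := fun a => F a x - F a y) (C := c)
        (.of_forall fun a => (hf.comp_cons a) i x y hxy)
      simpa using this
    have hint : ∀ φ : (Fin (n + 1) → S) → ℝ, Measurable φ → (∃ D, ∀ x, |φ x| ≤ D) →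
        ∫ x, φ x ∂(Measure.pi μ) = ∫ y, ∫ a, φ (Fin.cons a y) ∂(μ 0) ∂ν := by
      rintro φ hφ ⟨D, hD⟩
      rw [← hmp.map_eq, integral_map hmp.measurable.aemeasurable
        hφ.stronglyMeasurable.aestronglyMeasurable]
      exact integral_prod_symm _ (integrable_of_measurable_of_abs_le (hφ.comp hmp.measurable)
        fun z => hD _)
    set m := ∫ z, f z ∂(Measure.pi μ) with hmdef
    have hmg : m = ∫ y, g y ∂ν := hint f hm ⟨C, hC⟩
    have hfmC : ∀ x, |f x - m| ≤ C + |m| := fun x => (abs_sub _ _).trans (by gcongr; exact hC x)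
    have hgmC : ∀ y, |g y - m| ≤ C + |m| := fun y => (abs_sub _ _).trans (by gcongr; exact hgC y)
    rw [hint _ (by fun_prop) ⟨Real.exp (|t| * (C + |m|)), fun x => by
      rw [Real.abs_exp, Real.exp_le_exp]
      refine (le_abs_self _).trans ?_
      rw [abs_mul]
      exact mul_le_mul_of_nonneg_left (hfmC x) (abs_nonneg t)⟩]
    calc ∫ y, ∫ a, Real.exp (t * (f (Fin.cons a y) - m)) ∂(μ 0) ∂ν
        ≤ ∫ y, Real.exp ((c / 2) ^ 2 * t ^ 2 / 2) * Real.exp (t * (g y - m)) ∂ν := by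
          refine integral_mono_of_nonneg
            (.of_forall fun y => integral_nonneg fun a => (Real.exp_pos _).le)
            ((integrable_exp_mul_of_abs_le (by fun_prop) hgmC t).const_mul _)
            (.of_forall fun y => ?_)
          have h : ∀ a, Real.exp (t * (f (Fin.cons a y) - m))
              = Real.exp (t * (F a y - g y)) * Real.exp (t * (g y - m)) := fun a => by
            rw [← Real.exp_add]; congr 1; simp only [hF]; ring
          simp only [h, integral_mul_const]
          gcongr
          exact integral_exp_mul_sub_integral_le (hFm' y)
            (fun a b => hf.abs_cons_sub_cons_le a b y) t
      _ ≤ Real.exp ((c / 2) ^ 2 * t ^ 2 / 2) * Real.exp (n * (c / 2) ^ 2 * t ^ 2 / 2) := by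
          rw [integral_const_mul, hmg]
          gcongr
          exact ih hgbd hgm _
      _ = Real.exp ((n + 1 : ℕ) * (c / 2) ^ 2 * t ^ 2 / 2) := by
          rw [← Real.exp_add]; push_cast; congr 1; ring

/-- A function with bounded differences is sub-Gaussian under a product measure. -/
theorem HasBoundedDifferences.hasSubgaussianMGF {f : (Fin n → S) → ℝ}
    (hf : HasBoundedDifferences f c) (hm : Measurable f) (μ : Fin n → Measure S)
    [∀ i, IsProbabilityMeasure (μ i)] :
    HasSubgaussianMGF (fun x => f x - ∫ z, f z ∂(Measure.pi μ)) (n * (‖c‖₊ / 2) ^ 2)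
      (Measure.pi μ) := by
  refine ⟨fun t => ?_, fun t => ?_⟩
  -- `S` may be empty when `n = 0`; otherwise a probability measure on it supplies a point.
  · have hS : ∃ C, ∀ x, |f x| ≤ C := by
      rcases n with _ | n
      · exact ⟨|f finZeroElim|, fun x => by rw [Subsingleton.elim x finZeroElim]⟩
      · have : Nonempty S := nonempty_of_isProbabilityMeasure (μ 0)
        exact hf.exists_abs_le
    obtain ⟨C, hC⟩ := hS
    exact integrable_exp_mul_of_abs_le (by fun_prop)
      (fun x => (abs_sub (f x) _).trans (add_le_add_left (hC x) _)) t
  · refine (hf.integral_exp_le hm μ t).trans_eq ?_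
    simp [div_pow]

/-- **McDiarmid's inequality**. -/
theorem HasBoundedDifferences.measureReal_abs_ge_le {f : (Fin n → S) → ℝ}
    (hf : HasBoundedDifferences f c) (hm : Measurable f) (μ : Fin n → Measure S)
    [∀ i, IsProbabilityMeasure (μ i)] {η : ℝ} (hη : 0 ≤ η) :
    (Measure.pi μ).real {x | η ≤ |f x - ∫ z, f z ∂(Measure.pi μ)|} ≤
      2 * Real.exp (-2 * η ^ 2 / (n * c ^ 2)) := by
  have h := hf.hasSubgaussianMGF hm μ
  have h1 := h.measure_ge_le hη
  have h2 := h.neg.measure_ge_le hη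
  have hexp : -η ^ 2 / (2 * ((n * (‖c‖₊ / 2) ^ 2 : NNReal) : ℝ)) = -2 * η ^ 2 / (n * c ^ 2) := by
    push_cast
    rw [Real.norm_eq_abs, div_pow, sq_abs]
    rw [show 2 * ((n : ℝ) * (c ^ 2 / 2 ^ 2)) = (n * c ^ 2) / 2 by ring, div_div_eq_mul_div]
    ring
  rw [hexp] at h1 h2
  have hsub : {x | η ≤ |f x - ∫ z, f z ∂(Measure.pi μ)|} ⊆
      {x | η ≤ f x - ∫ z, f z ∂(Measure.pi μ)} ∪
        {x | η ≤ (-fun x => f x - ∫ z, f z ∂(Measure.pi μ)) x} := fun x (hx : η ≤ |_|) =>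
    (le_abs.1 hx : _ ∨ _)
  calc _ ≤ _ := measureReal_mono hsub
    _ ≤ _ := measureReal_union_le _ _
    _ ≤ _ := add_le_add h1 h2
    _ = _ := by ring

end McDiarmid

/-! ### The dual operator on densities of point masses -/

section PointDensity

/-- The density of the point mass at `x` with respect to `μ`, minus its mean `1`. -/
noncomputable def centeredPointDensity {S : Type*} [MeasurableSpace S] (μ : Measure S) (x : S) :
    S → ℝ :=
  fun z => ({x} : Set S).indicator (fun _ => (μ.real {x})⁻¹) z - 1

variable {S : Type*} [MeasurableSpace S] [MeasurableSingletonClass S] {μ : Measure S}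
  [IsProbabilityMeasure μ]

omit [IsProbabilityMeasure μ] in
lemma measurable_centeredPointDensity (μ : Measure S) (x : S) :
    Measurable (centeredPointDensity μ x) :=
  (measurable_const.indicator (measurableSet_singleton x)).sub_const 1

omit [IsProbabilityMeasure μ] in
lemma integral_centeredPointDensity (ν : Measure S)
    [IsProbabilityMeasure ν] (x : S) :
    ∫ z, centeredPointDensity μ x z ∂ν = ν.real {x} / μ.real {x} - 1 := by
  unfold centeredPointDensity
  rw [integral_sub _ (integrable_const _), integral_indicator (measurableSet_singleton x)]
  · simp [div_eq_mul_inv, Measure.real]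
  · exact (integrable_const _).indicator (measurableSet_singleton x)

lemma memLp_centeredPointDensity (p : ℝ≥0∞) (x : S) :
    MemLp (centeredPointDensity μ x) p μ := by
  refine MemLp.of_bound (measurable_centeredPointDensity μ x).aestronglyMeasurable
    ((μ.real {x})⁻¹ + 1) (.of_forall fun z => ?_)
  refine (norm_sub_le _ _).trans ?_
  rw [norm_one]
  gcongr
  refine (norm_indicator_le_norm_self _ _).trans_eq ?_
  simp

lemma eLpNorm_centeredPointDensity {p : ℝ} (hp : 0 < p) {x : S}
    (hx : μ {x} ≠ 0) :
    eLpNorm (centeredPointDensity μ x) (ENNReal.ofReal p) μ =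
      ((1 - μ {x}) ^ p * μ {x} ^ (1 - p) + (1 - μ {x})) ^ (1 / p) := by
  have hfin : μ {x} ≠ ∞ := measure_ne_top _ _
  rw [eLpNorm_eq_lintegral_rpow_enorm_toReal (by simpa using hp) ENNReal.ofReal_ne_top,
    ENNReal.toReal_ofReal hp.le, ← lintegral_add_compl _ (measurableSet_singleton x),
    lintegral_singleton]
  -- With `m = μ {x}`, the function equals `(1 - m) / m` at `x`, contributing `(1 - m)^p m^(1 - p)`,
  -- and `-1` elsewhere, contributing `1 - m`.
  congr 2
  · have h1 : μ.real {x} ≤ 1 := measureReal_le_one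
    have h0 : 0 < μ.real {x} := ENNReal.toReal_pos hx hfin
    have : ‖centeredPointDensity μ x x‖ₑ = (1 - μ {x}) * (μ {x})⁻¹ := by
      have h : centeredPointDensity μ x x = (1 - μ.real {x}) * (μ.real {x})⁻¹ := by
        simp only [centeredPointDensity, Set.indicator_of_mem (Set.mem_singleton x)]
        field_simp
      rw [h, Real.enorm_of_nonneg (by have := sub_nonneg.2 h1; positivity),
        ENNReal.ofReal_mul (sub_nonneg.2 h1), ENNReal.ofReal_sub _ h0.le,
        ENNReal.ofReal_inv_of_pos h0, ofReal_measureReal, ENNReal.ofReal_one]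
    rw [this, ENNReal.mul_rpow_of_nonneg _ _ hp.le, ENNReal.inv_rpow, mul_assoc,
      ENNReal.rpow_sub _ _ hx hfin, ENNReal.rpow_one, ENNReal.div_eq_inv_mul]
  · rw [setLIntegral_congr_fun (g := fun _ => 1) (measurableSet_singleton x).compl fun z hz => ?_]
    · simp [prob_compl_eq_one_sub (measurableSet_singleton x)]
    · simp [centeredPointDensity, Set.indicator_of_notMem hz]

lemma eLpNorm_centeredPointDensity_le {p : ℝ} (hp : 0 < p) {x : S}
    (hx : μ {x} ≠ 0) :
    eLpNorm (centeredPointDensity μ x) (ENNReal.ofReal p) μ ≤ pointMassNorm p μ := by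
  rw [eLpNorm_centeredPointDensity hp hx]
  exact le_iSup₂_of_le (f := fun (x : S) (_ : μ {x} ≠ 0) =>
    ((1 - μ {x}) ^ p * μ {x} ^ (1 - p) + (1 - μ {x})) ^ (1 / p)) x hx le_rfl

end PointDensity

section Dual

variable {S : Type*} [MeasurableSpace S] [StandardBorelSpace S] [Nonempty S]
  {K : Kernel S S} [IsMarkovKernel K] {μ : Measure S} [IsProbabilityMeasure μ]

lemma dualOperator_ae_eq_zero {g : S → ℝ} (hg : g =ᵐ[μ] 0) :
    dualOperator K μ g =ᵐ[K ∘ₘ μ] 0 := by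
  rw [← posterior_comp_self (μ := μ) (κ := K)] at hg
  filter_upwards [Measure.ae_ae_of_ae_comp hg] with y hy
  exact integral_eq_zero_of_ae hy

lemma eLpNorm_dualOperator_le {p : ℝ≥0∞} (hp : p ≠ 0) {g : S → ℝ} (hg : MemLp g p μ)
    (hg0 : ∫ x, g x ∂μ = 0) :
    eLpNorm (dualOperator K μ g) p (K ∘ₘ μ) ≤ dualContractionCoeff p K μ * eLpNorm g p μ := by
  -- A zero denominator must be treated apart: there the dual operator also gives zero, because it
  -- respects almost everywhere equality.
  by_cases h0 : eLpNorm g p μ = 0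
  · rw [eLpNorm_congr_ae (dualOperator_ae_eq_zero ((eLpNorm_eq_zero_iff hg.1 hp).1 h0))]
    simp
  · rw [← ENNReal.div_le_iff h0 hg.eLpNorm_ne_top]
    exact le_iSup₂_of_le g hg (le_iSup_of_le hg0 le_rfl)

/-- Bayes' rule for the posterior at atoms. -/
lemma comp_singleton_mul_posterior_singleton (x y : S) :
    (K ∘ₘ μ) {y} * (K†μ) y {x} = μ {x} * K x {y} := by
  have h := congrArg (fun ρ : Measure (S × S) => ρ ({y} ×ˢ {x}))
    (compProd_posterior_eq_map_swap (μ := μ) (κ := K))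
  beta_reduce at h
  rw [Measure.map_apply measurable_swap (by measurability), Set.preimage_swap_prod,
    Measure.compProd_apply_prod (by measurability) (by measurability),
    Measure.compProd_apply_prod (by measurability) (by measurability)] at h
  simpa [mul_comm] using h

/-- The `L_p` norm of the density of `K x` with respect to `K ∘ₘ μ`, for an atom `x` of `μ`. -/
lemma lintegral_singleton_div_rpow_le [Countable S] {p : ℝ}
    (hp : 1 ≤ p) {x : S} (hx : μ {x} ≠ 0) :
    (∫⁻ y, (K x {y} / (K ∘ₘ μ) {y}) ^ p ∂(K ∘ₘ μ)) ^ (1 / p) ≤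
      dualContractionCoeff (ENNReal.ofReal p) K μ * pointMassNorm p μ + 1 := by
  have hp0 : 0 < p := by linarith
  have hfin : μ {x} ≠ ∞ := measure_ne_top _ _
  set g := centeredPointDensity μ x
  have hμx : 0 < μ.real {x} := ENNReal.toReal_pos hx hfin
  have hdual : ∀ y, dualOperator K μ g y + 1 = ((K†μ) y).real {x} / μ.real {x} := fun y => by
    rw [dualOperator, integral_centeredPointDensity, sub_add_cancel]
  have hnorm : ∀ y, (K ∘ₘ μ) {y} ≠ 0 →
      K x {y} / (K ∘ₘ μ) {y} = ‖dualOperator K μ g y + 1‖ₑ := fun y hy => by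
    rw [hdual, Real.enorm_of_nonneg (by positivity), ENNReal.ofReal_div_of_pos hμx,
      ofReal_measureReal, ofReal_measureReal,
      ENNReal.div_eq_div_iff hx hfin hy (measure_ne_top _ _),
      ← comp_singleton_mul_posterior_singleton]
  have hae : ∀ᵐ y ∂(K ∘ₘ μ), (K ∘ₘ μ) {y} ≠ 0 := ae_iff_of_countable.2 fun y hy => hy
  have hmeas : ∀ φ : S → ℝ, AEStronglyMeasurable φ (K ∘ₘ μ) := fun φ =>
    (measurable_of_countable φ).aestronglyMeasurable
  calc (∫⁻ y, (K x {y} / (K ∘ₘ μ) {y}) ^ p ∂(K ∘ₘ μ)) ^ (1 / p)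
      = eLpNorm (dualOperator K μ g + fun _ => 1) (ENNReal.ofReal p) (K ∘ₘ μ) := by
        rw [eLpNorm_eq_lintegral_rpow_enorm_toReal (by simpa using hp0) ENNReal.ofReal_ne_top,
          ENNReal.toReal_ofReal hp0.le]
        congr 1
        refine lintegral_congr_ae ?_
        filter_upwards [hae] with y hy
        rw [hnorm y hy, Pi.add_apply]
    _ ≤ eLpNorm (dualOperator K μ g) (ENNReal.ofReal p) (K ∘ₘ μ) +
        eLpNorm (fun _ : S => (1 : ℝ)) (ENNReal.ofReal p) (K ∘ₘ μ) :=
        eLpNorm_add_le (hmeas _) (hmeas _) (by simpa using hp)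
    _ ≤ dualContractionCoeff (ENNReal.ofReal p) K μ * pointMassNorm p μ + 1 := by
        gcongr
        · refine (eLpNorm_dualOperator_le (by simpa using hp0) (memLp_centeredPointDensity _ x)
            ?_).trans ?_
          · rw [integral_centeredPointDensity, div_self hμx.ne', sub_self]
          · gcongr
            exact eLpNorm_centeredPointDensity_le hp0 hx
        · rw [eLpNorm_const _ (by simpa using hp0) (IsProbabilityMeasure.ne_zero _)]
          simp

end Dual

/-! ### The joint law of a Markov chain -/

section Chain

variable {Ω S : Type*} [MeasurableSpace Ω] [MeasurableSpace S] {P : Measure Ω}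
  [IsProbabilityMeasure P] {n : ℕ} {K : Fin n → Kernel S S} {X : Fin (n + 1) → Ω → S}

lemma IsMarkovChain.measure_inter_preimage [∀ i, IsMarkovKernel (K i)] (h : IsMarkovChain P X K)
    (hX : ∀ i, Measurable (X i))
    (i : Fin n) {E : Set S} (hE : MeasurableSet E) {B : Set Ω}
    (hB : MeasurableSet[⨆ j ≤ i.castSucc, MeasurableSpace.comap (X j) inferInstance] B) :
    P (B ∩ X i.succ ⁻¹' E) = ∫⁻ ω in B, K i (X i.castSucc ω) E ∂P := by
  have hle : (⨆ j ≤ i.castSucc, MeasurableSpace.comap (X j) inferInstance) ≤ ‹MeasurableSpace Ω› :=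
    iSup₂_le fun j _ => (hX j).comap_le
  have hA : MeasurableSet (X i.succ ⁻¹' E) := hX _ hE
  have h1 := setIntegral_condExp (μ := P) (f := (X i.succ ⁻¹' E).indicator fun _ => (1 : ℝ)) hle
    ((integrable_const _).indicator hA) hB
  rw [setIntegral_congr_ae (hle _ hB) ((h i E hE).mono fun ω hω _ => hω),
    integral_indicator hA, Measure.restrict_restrict hA, setIntegral_const, smul_eq_mul, mul_one,
    Set.inter_comm] at h1
  rw [← ofReal_measureReal, ← h1, ofReal_integral_eq_lintegral_ofReal]
  · exact lintegral_congr fun ω => ofReal_measureReal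
  · refine Integrable.of_bound (C := 1) ?_ (.of_forall fun ω => ?_)
    · exact ((((K i).measurable_coe hE).comp (hX _)).ennreal_toReal).aestronglyMeasurable
    · rw [Real.norm_of_nonneg measureReal_nonneg]; exact measureReal_le_one
  · exact .of_forall fun ω => measureReal_nonneg

lemma IsMarkovChain.map_succ [∀ i, IsMarkovKernel (K i)] (h : IsMarkovChain P X K)
    (hX : ∀ i, Measurable (X i)) (i : Fin n) :
    P.map (X i.succ) = K i ∘ₘ P.map (X i.castSucc) := by
  ext E hE
  rw [Measure.bind_apply hE (K i).aemeasurable, lintegral_map ((K i).measurable_coe hE) (hX _),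
    Measure.map_apply (hX _) hE]
  simpa using h.measure_inter_preimage hX i hE MeasurableSet.univ

/-- Each induction step conditions on the path so far: that event lies in the past, and on it the
next transition probability is constant. -/
lemma IsMarkovChain.measure_iInter_eq [MeasurableSingletonClass S] [∀ i, IsMarkovKernel (K i)]
    (h : IsMarkovChain P X K) (hX : ∀ i, Measurable (X i)) (x : Fin (n + 1) → S)
    (i : Fin (n + 1)) :
    P (⋂ j ≤ i, X j ⁻¹' {x j}) =
      P.map (X 0) {x 0} * ∏ j with j.castSucc < i, K j (x j.castSucc) {x j.succ} := by
  induction i using Fin.induction with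
  | zero => simp [Measure.map_apply (hX 0)]
  | succ i ih =>
    have hset : (⋂ j ≤ i.succ, X j ⁻¹' {x j}) =
        (⋂ j ≤ i.castSucc, X j ⁻¹' {x j}) ∩ X i.succ ⁻¹' {x i.succ} := by
      ext ω
      simp only [Set.mem_iInter, Set.mem_inter_iff]
      refine ⟨fun H => ⟨fun j hj => H j (hj.trans (Fin.castSucc_lt_succ).le), H _ le_rfl⟩,
        fun H j hj => ?_⟩
      rcases hj.lt_or_eq with hj | rfl
      · exact H.1 j (Fin.le_castSucc_iff.2 hj)
      · exact H.2
    have hfil : (Finset.univ.filter fun j : Fin n => j.castSucc < i.succ) =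
        insert i (Finset.univ.filter fun j : Fin n => j.castSucc < i.castSucc) := by
      ext j
      simp only [Finset.mem_filter, Finset.mem_univ, true_and, Finset.mem_insert,
        Fin.castSucc_lt_succ_iff, Fin.castSucc_lt_castSucc_iff]
      exact le_iff_eq_or_lt
    have hB : MeasurableSet[⨆ j ≤ i.castSucc, MeasurableSpace.comap (X j) inferInstance]
        (⋂ j ≤ i.castSucc, X j ⁻¹' {x j}) := by
      refine MeasurableSet.iInter fun j => MeasurableSet.iInter fun hj => ?_
      exact (le_iSup₂_of_le (f := fun j (_ : j ≤ i.castSucc) =>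
        MeasurableSpace.comap (X j) inferInstance) j hj le_rfl) _
        ⟨{x j}, measurableSet_singleton _, rfl⟩
    have hBm : MeasurableSet (⋂ j ≤ i.castSucc, X j ⁻¹' {x j}) :=
      MeasurableSet.iInter fun j => MeasurableSet.iInter fun _ => hX j (measurableSet_singleton _)
    rw [hset, h.measure_inter_preimage hX i (measurableSet_singleton _) hB,
      setLIntegral_congr_fun (g := fun _ => K i (x i.castSucc) {x i.succ}) hBm fun ω hω => ?_,
      setLIntegral_const, ih, hfil, Finset.prod_insert (by simp)]
    · ring
    · have : X i.castSucc ω = x i.castSucc := by simpa using Set.mem_iInter₂.1 hω _ le_rfl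
      simp only [this]

lemma IsMarkovChain.measure_eq_prod [MeasurableSingletonClass S] [∀ i, IsMarkovKernel (K i)]
    (h : IsMarkovChain P X K) (hX : ∀ i, Measurable (X i)) (x : Fin (n + 1) → S) :
    P.map (fun ω i => X i ω) {x} =
      P.map (X 0) {x 0} * ∏ j, K j (x j.castSucc) {x j.succ} := by
  rw [Measure.map_apply (measurable_pi_lambda _ hX) (measurableSet_singleton _)]
  have := h.measure_iInter_eq hX x (Fin.last n)
  simp only [Fin.le_last, Set.iInter_true, Fin.castSucc_lt_last, Finset.filter_true] at this
  rw [← this]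
  congr 1
  ext ω
  simp [funext_iff]

/-- The joint law of a Markov chain has an explicit density with respect to the product of its
marginals. -/
lemma IsMarkovChain.map_eq_withDensity [Countable S] [MeasurableSingletonClass S]
    [∀ i, IsMarkovKernel (K i)] (h : IsMarkovChain P X K) (hX : ∀ i, Measurable (X i)) :
    P.map (fun ω i => X i ω) = (Measure.pi fun i => P.map (X i)).withDensity
      fun x => ∏ j, K j (x j.castSucc) {x j.succ} / P.map (X j.succ) {x j.succ} := by
  have hprob : ∀ i, IsProbabilityMeasure (P.map (X i)) := fun i =>
    Measure.isProbabilityMeasure_map (hX i).aemeasurable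
  refine Measure.ext_of_singleton fun x => ?_
  rw [withDensity_apply _ (measurableSet_singleton _), lintegral_singleton, Measure.pi_singleton]
  -- Where a marginal vanishes, both sides are zero whatever value the quotients take; elsewhere the
  -- denominators cancel.
  by_cases h0 : ∃ i, P.map (X i) {x i} = 0
  · obtain ⟨i, hi⟩ := h0
    rw [Finset.prod_eq_zero (Finset.mem_univ i) hi, mul_zero,
      Measure.map_apply (measurable_pi_lambda _ hX) (measurableSet_singleton _)]
    rw [Measure.map_apply (hX i) (measurableSet_singleton _)] at hi
    exact measure_mono_null (fun ω hω => congrFun hω i) hi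
  · push Not at h0
    rw [h.measure_eq_prod hX, Fin.prod_univ_succ, mul_left_comm, ← Finset.prod_mul_distrib]
    congr 1
    exact Finset.prod_congr rfl fun j _ => (ENNReal.div_mul_cancel (h0 _) (measure_ne_top _ _)).symm

end Chain

/-! ### Product integrals, Hölder's inequality and the final bound -/

/-- Integrating a product of consecutive transition functions, last coordinate first. -/
lemma lintegral_pi_prod_le {S : Type*} [MeasurableSpace S] [Countable S]
    [MeasurableSingletonClass S] {n : ℕ} (μ : Fin (n + 1) → Measure S)
    [∀ i, IsProbabilityMeasure (μ i)] (k : Fin n → S → S → ℝ≥0∞) (M : Fin n → ℝ≥0∞)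
    (hk : ∀ i x, μ i.castSucc {x} ≠ 0 → ∫⁻ y, k i x y ∂(μ i.succ) ≤ M i) :
    ∫⁻ x, ∏ i, k i (x i.castSucc) (x i.succ) ∂(Measure.pi μ) ≤ ∏ i, M i := by
  induction n with
  | zero => simp
  | succ n ih =>
    set ν := Measure.pi fun j : Fin (n + 1) => μ j.castSucc with hν
    have hmp : MeasurePreserving
        (fun z : S × (Fin (n + 1) → S) => (Fin.snoc z.2 z.1 : Fin (n + 2) → S))
        ((μ (Fin.last _)).prod ν) (Measure.pi μ) := by
      have := (measurePreserving_piFinSuccAbove μ (Fin.last _)).symm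
      simpa [MeasurableEquiv.piFinSuccAbove, Fin.insertNthEquiv] using! this
    -- The bound `hk` is only available at atoms, which carry all the mass.
    have hae : ∀ᵐ y ∂ν, μ (Fin.last n).castSucc {y (Fin.last n)} ≠ 0 := by
      refine ae_iff_of_countable.2 fun y hy h0 => hy ?_
      rw [hν, Measure.pi_singleton]
      exact Finset.prod_eq_zero (Finset.mem_univ (Fin.last n)) h0
    rw [← hmp.map_eq, lintegral_map (measurable_of_countable _) hmp.measurable,
      lintegral_prod_symm' _ (measurable_of_countable _)]
    calc _ ≤ ∫⁻ y, (∏ i : Fin n, k i.castSucc (y i.castSucc) (y i.succ)) * M (Fin.last n) ∂ν := by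
          refine lintegral_mono_ae ?_
          filter_upwards [hae] with y hy
          simp only [Fin.prod_univ_castSucc, Fin.succ_castSucc, Fin.snoc_castSucc, Fin.succ_last,
            Fin.snoc_last]
          rw [lintegral_const_mul _ (measurable_of_countable _)]
          gcongr
          exact hk (Fin.last n) _ hy
      _ ≤ (∏ i : Fin n, M i.castSucc) * M (Fin.last n) := by
          rw [lintegral_mul_const _ (measurable_of_countable _)]
          gcongr
          exact ih (fun j => μ j.castSucc) (fun i => k i.castSucc) _ fun i x hx =>
            hk i.castSucc x hx
      _ = ∏ i, M i := (Fin.prod_univ_castSucc M).symm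

/-- Comparison of a measure with density to its base measure by Hölder's inequality. -/
lemma withDensity_le_rpow_mul_rpow {α : Type*} [MeasurableSpace α] (μ : Measure α) {p q : ℝ}
    (hpq : p.HolderConjugate q) {D : α → ℝ≥0∞} (hD : Measurable D) {A : Set α}
    (hA : MeasurableSet A) :
    μ.withDensity D A ≤ (∫⁻ x, D x ^ p ∂μ) ^ (1 / p) * μ A ^ (1 / q) := by
  have h := ENNReal.lintegral_mul_le_Lp_mul_Lq μ hpq hD.aemeasurable
    ((measurable_const (a := (1 : ℝ≥0∞))).indicator hA).aemeasurable
  have h1 : ∀ x, (D * A.indicator (fun _ => (1 : ℝ≥0∞)) : α → ℝ≥0∞) x = A.indicator D x := fun x => by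
    by_cases hx : x ∈ A <;> simp [hx]
  have h2 : ∀ x, (A.indicator (fun _ => (1 : ℝ≥0∞)) x) ^ q = A.indicator (fun _ => 1) x :=
    fun x => by by_cases hx : x ∈ A <;> simp [hx, hpq.symm.pos]
  simp only [h1, h2, lintegral_indicator hA, setLIntegral_one] at h
  rwa [withDensity_apply _ hA]

theorem mainTheorem12 {Ω S : Type*} [MeasurableSpace Ω]
    [Countable S] [Nonempty S] [MeasurableSpace S] [MeasurableSingletonClass S]
    (P : Measure Ω) [IsProbabilityMeasure P] (n : ℕ)
    (K : Fin n → Kernel S S) [∀ i, IsMarkovKernel (K i)]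
    (X : Fin (n + 1) → Ω → S) (hX : ∀ i, Measurable (X i))
    (hMarkov : IsMarkovChain P X K)
    (p q : ℝ) (hp : 1 < p) (hpq : p.HolderConjugate q)
    (f : (Fin (n + 1) → S) → ℝ) (hf : HasBoundedDifferences f (1 / ((n : ℝ) + 1)))
    (η : ℝ) (hη : 0 ≤ η) :
    P {ω | η ≤ |f (fun i => X i ω) - ∫ x, f x ∂(Measure.pi fun i => P.map (X i))|} ≤
      ENNReal.ofReal (2 ^ (1 / q) * Real.exp (-(2 * ((n : ℝ) + 1) * η ^ 2 / q))) *
        ∏ i : Fin n,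
          (dualContractionCoeff (ENNReal.ofReal p) (K i) (P.map (X i.castSucc)) *
            pointMassNorm p (P.map (X i.castSucc)) + 1) := by
  have hprob : ∀ i, IsProbabilityMeasure (P.map (X i)) := fun i =>
    Measure.isProbabilityMeasure_map (hX i).aemeasurable
  have hp0 : 0 < p := by linarith
  have hq0 : 0 < q := hpq.symm.pos
  set Q := Measure.pi fun i => P.map (X i)
  set A : Set (Fin (n + 1) → S) := {x | η ≤ |f x - ∫ z, f z ∂Q|}
  have hA : MeasurableSet A := A.to_countable.measurableSet
  set M : Fin n → ℝ≥0∞ := fun i =>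
    dualContractionCoeff (ENNReal.ofReal p) (K i) (P.map (X i.castSucc)) *
      pointMassNorm p (P.map (X i.castSucc)) + 1
  set k : Fin n → S → S → ℝ≥0∞ := fun i x y => K i x {y} / P.map (X i.succ) {y}
  -- There are `t = n + 1` coordinates and `c = 1 / t`, so `2 / (t c ^ 2) = 2 t`.
  have hMc : Q A ≤ ENNReal.ofReal (2 * Real.exp (-(2 * ((n : ℝ) + 1) * η ^ 2))) := by
    rw [← ofReal_measureReal]
    refine ENNReal.ofReal_le_ofReal ((hf.measureReal_abs_ge_le (measurable_of_countable f)
      (fun i => P.map (X i)) hη).trans_eq ?_)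
    congr 2
    push_cast
    field_simp
  have hdens : ∫⁻ x, (∏ j, k j (x j.castSucc) (x j.succ)) ^ p ∂Q ≤ ∏ i, M i ^ p := by
    simp only [← ENNReal.prod_rpow_of_nonneg hp0.le]
    refine lintegral_pi_prod_le (fun i => P.map (X i)) (fun i x y => k i x y ^ p) _ fun i x hx => ?_
    rw [← ENNReal.rpow_le_rpow_iff (z := 1 / p) (by positivity), ← ENNReal.rpow_mul,
      mul_one_div_cancel hp0.ne', ENNReal.rpow_one]
    simp only [k, hMarkov.map_succ hX i]
    exact lintegral_singleton_div_rpow_le hp.le hx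
  calc P {ω | η ≤ |f (fun i => X i ω) - ∫ x, f x ∂Q|}
      = P.map (fun ω i => X i ω) A := (Measure.map_apply (measurable_pi_lambda _ hX) hA).symm
    _ ≤ (∫⁻ x, (∏ j, k j (x j.castSucc) (x j.succ)) ^ p ∂Q) ^ (1 / p) * Q A ^ (1 / q) := by
        rw [hMarkov.map_eq_withDensity hX]
        exact withDensity_le_rpow_mul_rpow Q hpq (measurable_of_countable _) hA
    _ ≤ (∏ i, M i ^ p) ^ (1 / p) *
          ENNReal.ofReal (2 * Real.exp (-(2 * ((n : ℝ) + 1) * η ^ 2))) ^ (1 / q) := by gcongr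
    _ = _ := by
        -- The power `1 / q` turns `2` into `2 ^ (1 / q)` and divides the exponent by `q`.
        rw [mul_comm, ENNReal.ofReal_rpow_of_nonneg (by positivity) (by positivity),
          Real.mul_rpow (by norm_num) (by positivity), ← Real.exp_mul,
          ENNReal.prod_rpow_of_nonneg hp0.le, ← ENNReal.rpow_mul, mul_one_div_cancel hp0.ne',
          ENNReal.rpow_one]
        congr 5
        ring
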